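/- Let $S$ be a finite set and let $T$ be a collection of $3$-element subsets of $S$. Let $\mathcal K_T\subseteq(\mathbb C^2)^S$ be the affine variety of all assignments $(p_s)_{s\in S}$ of points $p_s\in\mathbb C^2$ such that $p_{s_1},p_{s_2},p_{s_3}$ are collinear for every $\{s_1,s_2,s_3\}\in T$. For a nonnegative integer $r$, a point $P\in\mathcal K_T$ is called $r$-rigid with respect to $T$ if every irreducible component of $\mathcal K_T$ (in the Zariski topology) that contains $P$ has dimension at most $r$. **Proposition.** Let $S_1,\dots,S_\ell$ be pairwise disjoint subsets of $S$, let $P=(p_s)_{s\in S}\in\mathcal K_T$, and for each $i\in\{1,\dots,\ell\}$ put $T_i=T\cap\binom{S_i}{3}$, a collection of triples in the ground set $S_i$, and $P_i=(p_s)_{s\in S_i}\in\mathcal K_{T_i}\subseteq(\mathbb C^2)^{S_i}$. Suppose that $P_i$ is $r$-rigid with respect to $T_i$ for every $i$, and that the only $P'=(p'_s)_{s\in S}\in\mathcal K_T$ satisfying $(p'_s)_{s\in S_i}=(p_s)_{s\in S_i}$ for all $i$ is $P'=P$. Then $P$ is $(\ell r)$-rigid with respect to $T$. -/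

import Mathlib

open MvPolynomial

/-- The Zariski topology on the affine space `ℂ^σ`: the closed sets are the common zero loci
of ideals of polynomials. -/
abbrev zariskiTopology (σ : Type*) : TopologicalSpace (σ → ℂ) :=
  TopologicalSpace.ofClosed {V | ∃ I : Ideal (MvPolynomial σ ℂ), V = zeroLocus ℂ I}
    ⟨⊤, by simp⟩
    (by
      intro A hA
      refine ⟨sSup {I | zeroLocus ℂ I ∈ A}, ?_⟩
      apply Set.Subset.antisymm
      · intro x hx
        have h : sSup {I : Ideal (MvPolynomial σ ℂ) | zeroLocus ℂ I ∈ A}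
            ≤ vanishingIdeal ℂ {x} := by
          refine sSup_le fun I hI => ?_
          intro p hp
          rw [mem_vanishingIdeal_singleton_iff]
          exact hx _ hI p hp
        intro p hp
        exact (mem_vanishingIdeal_singleton_iff x p).1 (h hp)
      · rintro x hx V hV
        obtain ⟨I, rfl⟩ := hA hV
        exact fun p hp => hx p ((le_sSup (show I ∈ {I | zeroLocus ℂ I ∈ A} from hV)) hp))
    (by
      rintro _ ⟨I, rfl⟩ _ ⟨J, rfl⟩
      refine ⟨I * J, Set.Subset.antisymm ?_ ?_⟩
      · rintro x (hx | hx) p hp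
        · exact hx p ((Ideal.mul_le_inf.trans inf_le_left : I * J ≤ I) hp)
        · exact hx p ((Ideal.mul_le_inf.trans inf_le_right : I * J ≤ J) hp)
      · intro x hx
        by_contra hcon
        simp only [Set.mem_union, not_or, mem_zeroLocus_iff, not_forall] at hcon
        obtain ⟨⟨p, hp, hpx⟩, ⟨q, hq, hqx⟩⟩ := hcon
        have := hx (p * q) (Ideal.mul_mem_mul hp hq)
        rw [map_mul, mul_eq_zero] at this
        exact this.elim hpx hqx)

/-- `V` is an irreducible component of `X ⊆ ℂ^σ`: a maximal irreducible subset of `X` in the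
Zariski topology. -/
def IsZariskiComponent {σ : Type*} (X V : Set (σ → ℂ)) : Prop :=
  Maximal (fun W : Set (σ → ℂ) => W ⊆ X ∧ @IsIrreducible _ (zariskiTopology σ) W) V

/-- The dimension of an affine variety `V ⊆ ℂ^σ`: the Krull dimension of its coordinate ring. -/
noncomputable def zariskiDim {σ : Type*} (V : Set (σ → ℂ)) : WithBot ℕ∞ :=
  ringKrullDim (MvPolynomial σ ℂ ⧸ vanishingIdeal ℂ V)

/-- The set of all assignments of points `p s ∈ ℂ²` to the elements `s` of `S` such that for each
triple in `T` the assigned points are collinear. -/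
def collinearityVariety {S : Type*} (T : Set (Finset S)) : Set (S → Fin 2 → ℂ) :=
  {p | ∀ t ∈ T, Collinear ℂ (p '' (t : Set S))}

/-- `P` is `r`-rigid with respect to `T`: every irreducible component through `P` of the variety
of `T` has dimension at most `r`. The space `(ℂ²)^S` is identified with the affine space
`ℂ^(S × {0, 1})` by `Function.uncurry`. -/
def IsRigid {S : Type*} (r : ℕ) (T : Set (Finset S)) (P : S → Fin 2 → ℂ) : Prop :=
  ∀ V : Set (S × Fin 2 → ℂ),
    IsZariskiComponent (Function.uncurry '' collinearityVariety T) V →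
    Function.uncurry P ∈ V → zariskiDim V ≤ (r : WithBot ℕ∞)

/-- The triples of `T` that are contained in `A`, as triples in the ground set `A`. -/
def restrictTriples {S : Type*} (T : Set (Finset S)) (A : Set S) : Set (Finset A) :=
  {t | t.map (Function.Embedding.subtype (· ∈ A)) ∈ T}

/-!
Let `V` be an irreducible component of the collinearity variety of `T` through `P`, and project it
to the coordinates indexed by each `A i`. The projection is irreducible and contains the
restriction of `P`, so it lies in a component of the variety of `restrictTriples T (A i)` through
that point, which has dimension at most `r` by rigidity. Hence the joint projection of `V` to all
these coordinates has an image of dimension at most `ℓ * r`. By uniqueness `P` is the only point of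
`V` in its fibre, so the projection is generically finite onto its image, and `dim V ≤ ℓ * r`.

The last step is done in the coordinate ring `R` of `V`. Let `B ⊆ R` be the subalgebra generated by
the coordinates indexed by the sets `A i`. Since `P` is isolated in its fibre, Zariski's main
theorem makes `R` quasi-finite over `B` at `P`, hence at the generic point, and so `R` is algebraic
over `B` (`isAlgebraic_of_forall_comap_eq`). The algebraic matroid of `R` then bounds the
transcendence degree of `R` by the sum of those of the projections
(`trdeg_le_mul_of_isAlgebraic_adjoin_iUnion`), and transcendence degree is Krull dimension by
Noether normalization (`exists_ringKrullDim_eq_and_trdeg_eq`).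
-/

/-! ### Dimension and transcendence degree -/

/-- The Krull dimension and the transcendence degree of a finitely generated domain `D` over a field
are the same natural number: both equal the number of variables in a Noether normalization of `D`. -/
theorem exists_ringKrullDim_eq_and_trdeg_eq (k D : Type*) [Field k] [CommRing D] [IsDomain D]
    [Algebra k D] [Algebra.FiniteType k D] :
    ∃ d : ℕ, ringKrullDim D = d ∧ Algebra.trdeg k D = d := by
  obtain ⟨d, g, hinj, hint⟩ := exists_integral_inj_algHom_of_fg k D
  refine ⟨d, ?_, ?_⟩
  · have hd : ringKrullDim (MvPolynomial (Fin d) k) = d := by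
      rw [MvPolynomial.ringKrullDim_of_isNoetherianRing]; simp
    algebraize [g.toRingHom]
    rw [← hd]
    apply le_antisymm
    · exact Order.krullDim_le_of_strictMono
        (PrimeSpectrum.comap (algebraMap (MvPolynomial (Fin d) k) D))
        fun p q hpq => Ideal.IsIntegral.comap_lt_comap hpq
    -- lift a chain of primes by lying over for its head and going up for the rest
    · refine iSup_le fun l => ?_
      obtain ⟨Q, -, hQ, hQl⟩ := Ideal.exists_ideal_over_prime_of_isIntegral (S := D) l.head.asIdeal
        ⊥ (by
          have : RingHom.ker (algebraMap (MvPolynomial (Fin d) k) D) = ⊥ :=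
            (RingHom.injective_iff_ker_eq_bot _).1 hinj
          rw [← RingHom.ker_eq_comap_bot, this]; exact bot_le)
      have : Q.LiesOver l.head.asIdeal := ⟨hQl.symm⟩
      obtain ⟨L, hL, -⟩ := Ideal.exists_ltSeries_of_hasGoingUp l Q
      rw [← hL]
      exact le_iSup (fun p : LTSeries (PrimeSpectrum D) => (p.length : WithBot ℕ∞)) L
  · have hb : IsTranscendenceBasis k (fun i => g (X i)) := by
      rw [isTranscendenceBasis_iff_algebraicIndependent_isAlgebraic]
      refine ⟨(algebraicIndependent_X (Fin d) k).map' hinj, ?_⟩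
      have hr : Algebra.adjoin k (Set.range fun i => g (X i)) = g.range := by
        rw [← Algebra.map_top, ← MvPolynomial.adjoin_range_X, AlgHom.map_adjoin, ← Set.range_comp]
        rfl
      rw [hr]
      refine ⟨fun x => ?_⟩
      obtain ⟨p, hp, hpx⟩ := hint x
      refine IsIntegral.isAlgebraic
        ⟨p.map g.rangeRestrict.toRingHom, hp.map _, ?_⟩
      rw [Polynomial.eval₂_map]
      exact hpx
    simpa using hb.lift_cardinalMk_eq_trdeg.symm

/-- If a prime `m` of `R` is the only point of its fibre over `B`, then `R` is algebraic over `B`.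
Indeed `R` is then quasi-finite over `B` at `m`, hence at the smaller prime `⊥`, so that the
extension of fraction fields is finite. -/
theorem isAlgebraic_of_forall_comap_eq {B R : Type*} [CommRing B] [CommRing R] [IsDomain B]
    [IsDomain R] [Algebra B R] [FaithfulSMul B R] [Algebra.FiniteType B R] (m : Ideal R)
    [hm : m.IsPrime]
    (h : ∀ p : Ideal R, p.IsPrime → p.comap (algebraMap B R) = m.comap (algebraMap B R) → p = m) :
    Algebra.IsAlgebraic B R := by
  have hq : Algebra.QuasiFiniteAt B m := by
    refine Algebra.QuasiFiniteAt.of_isOpen_singleton_fiber ⟨m, hm⟩ ?_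
    convert! isOpen_univ
    refine (Set.eq_univ_of_forall fun p => ?_)
    exact Subtype.ext (PrimeSpectrum.ext (h _ p.1.2 (congrArg PrimeSpectrum.asIdeal p.2)))
  have : Algebra.QuasiFiniteAt B (⊥ : Ideal R) := .of_le (bot_le : ⊥ ≤ m)
  have hc : (⊥ : Ideal R).primeCompl = nonZeroDivisors R := by
    ext; simp [Ideal.primeCompl]
  have : IsFractionRing R (Localization.AtPrime (⊥ : Ideal R)) := by
    rw [IsFractionRing, ← hc]
    infer_instance
  let e : Localization.AtPrime (⊥ : Ideal R) ≃ₐ[R] FractionRing R :=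
    IsLocalization.algEquiv (nonZeroDivisors R) _ _
  have : Algebra.QuasiFinite B (FractionRing R) :=
    (Algebra.QuasiFinite.iff_of_algEquiv (e.restrictScalars B)).1 inferInstance
  have : FaithfulSMul B (FractionRing R) := .trans B R (FractionRing R)
  let _ : Algebra (FractionRing B) (FractionRing R) := FractionRing.liftAlgebra B _
  have : Algebra.QuasiFinite (FractionRing B) (FractionRing R) := .of_restrictScalars B _ _
  have : Module.Finite (FractionRing B) (FractionRing R) := .of_quasiFinite
  have : Algebra.IsAlgebraic (FractionRing B) (FractionRing R) := .of_finite _ _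
  have : Algebra.IsAlgebraic B (FractionRing R) :=
    (IsFractionRing.comap_isAlgebraic_iff (K := FractionRing B)).2 this
  exact .tower_bot_of_injective (A := FractionRing R) (IsFractionRing.injective R (FractionRing R))

open Cardinal in
/-- Subadditivity of the rank of the algebraic matroid of `R` over `k`: if `R` is algebraic over the
algebra generated by `ℓ` sets of rank at most `r`, its transcendence degree is at most `ℓ * r`. -/
theorem trdeg_le_mul_of_isAlgebraic_adjoin_iUnion {k R : Type*} [Field k] [CommRing R] [IsDomain R]
    [Algebra k R] {ℓ r : ℕ} (G : Fin ℓ → Set R)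
    [Algebra.IsAlgebraic (Algebra.adjoin k (⋃ i, G i)) R]
    (h : ∀ i, ∀ s ⊆ G i, AlgebraicIndepOn k id s → #s ≤ r) :
    Algebra.trdeg k R ≤ (ℓ * r : ℕ) := by
  choose s hs using fun i => (AlgebraicIndependent.matroid k R).exists_isBasis (G i)
  have hspan : (AlgebraicIndependent.matroid k R).Spanning (⋃ i, s i) := by
    rw [Matroid.spanning_iff_closure_eq,
      Matroid.closure_iUnion_congr s G fun i => (hs i).closure_eq_closure,
      ← Matroid.spanning_iff_closure_eq]
    exact AlgebraicIndependent.matroid_spanning_iff.2 ‹_›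
  have := (AlgebraicIndependent.matroid_spanning_iff).1 hspan
  refine (Algebra.IsAlgebraic.trdeg_le_cardinalMk k (⋃ i, s i)).trans ?_
  have hsum := (mk_iUnion_le_sum_mk_lift (f := s)).trans
    (sum_le_sum _ (fun _ => (r : Cardinal)) fun i => h i _ (hs i).subset (hs i).indep)
  simpa using hsum

/-- Algebraic form of the dimension bound. The prime `I` stands for an irreducible subvariety of an
affine space, `m` for a point on it, `e i` for the `i`-th coordinate projection, and `J i` for an
irreducible variety of dimension at most `r` that contains the `i`-th projection of the subvariety.
The hypothesis `hiso` says that `m` is alone in its fibre under all the projections together. -/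
theorem ringKrullDim_quotient_le_mul_of_isolated {k σ : Type*} [Field k] [Finite σ] {ℓ r : ℕ}
    {τ : Fin ℓ → Type*} [∀ i, Finite (τ i)] (e : ∀ i, τ i → σ)
    (I m : Ideal (MvPolynomial σ k)) [I.IsPrime] [m.IsPrime] (hIm : I ≤ m)
    (J : ∀ i, Ideal (MvPolynomial (τ i) k)) [∀ i, (J i).IsPrime]
    (hJI : ∀ i, J i ≤ I.comap (rename (e i)))
    (hJ : ∀ i, ringKrullDim (MvPolynomial (τ i) k ⧸ J i) ≤ r)
    (hiso : ∀ q : Ideal (MvPolynomial σ k), q.IsPrime → I ≤ q →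
      (∀ i t c, X (e i t) - C c ∈ m → X (e i t) - C c ∈ q) → q = m) :
    ringKrullDim (MvPolynomial σ k ⧸ I) ≤ (ℓ * r : ℕ) := by
  let R := MvPolynomial σ k ⧸ I
  let π : MvPolynomial σ k →ₐ[k] R := Ideal.Quotient.mkₐ k I
  have hπ : Function.Surjective π := Ideal.Quotient.mk_surjective
  have hker : RingHom.ker π = I := Ideal.Quotient.mkₐ_ker k I
  let G : Fin ℓ → Set R := fun i => Set.range fun t => π (X (e i t))
  -- the coordinate ring of the closure of the joint projection, as a subalgebra of `R`
  let B := Algebra.adjoin k (⋃ i, G i)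
  have hBm : ∀ i t c, π (X (e i t) - C c) ∈ B := fun i t c => by
    rw [map_sub]
    refine B.sub_mem (Algebra.subset_adjoin (Set.mem_iUnion.2 ⟨i, t, rfl⟩)) ?_
    exact π.comp (Algebra.ofId k _) |>.commutes c ▸ B.algebraMap_mem c
  have : Algebra.FiniteType B R := .of_restrictScalars_finiteType k B R
  have hm : (m.map π).IsPrime := Ideal.map_isPrime_of_surjective hπ (hker.trans_le hIm)
  have halg : Algebra.IsAlgebraic B R := by
    refine isAlgebraic_of_forall_comap_eq (m.map π) fun p hp hpm => ?_
    rw [← Ideal.map_comap_of_surjective π hπ p]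
    congr 1
    refine hiso _ (hp.comap π) ?_ fun i t c hc => ?_
    · exact hker.ge.trans (Ideal.comap_mono bot_le)
    · have : (⟨_, hBm i t c⟩ : B) ∈ (m.map π).comap (algebraMap B R) :=
        Ideal.mem_map_of_mem π hc
      rw [← hpm] at this
      exact this
  obtain ⟨d, hd, hd'⟩ := exists_ringKrullDim_eq_and_trdeg_eq k R
  have htr : Algebra.trdeg k R ≤ (ℓ * r : ℕ) := by
    refine trdeg_le_mul_of_isAlgebraic_adjoin_iUnion G fun i s hs hind => ?_
    obtain ⟨d, hd, hd'⟩ := exists_ringKrullDim_eq_and_trdeg_eq k (MvPolynomial (τ i) k ⧸ J i)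
    have hdr : d ≤ r := by
      have := hJ i
      rw [hd] at this
      exact_mod_cast this
    -- `φ` is dual to the `i`-th projection; independent coordinates lift along it
    choose j hj using fun a : s => hs a.2
    let φ : (MvPolynomial (τ i) k ⧸ J i) →ₐ[k] R :=
      Ideal.Quotient.liftₐ (J i) (π.comp (rename (e i))) fun a ha =>
        Ideal.Quotient.eq_zero_iff_mem.2 (hJI i ha)
    have hlift : AlgebraicIndependent k
        (fun a : s => Ideal.Quotient.mkₐ k (J i) (X (j a))) := by
      refine .of_comp φ ?_
      convert! hind with a
      change π (rename (e i) (X (j a))) = a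
      rw [rename_X]
      exact hj a
    have := hlift.lift_cardinalMk_le_trdeg
    rw [hd'] at this
    have h2 : Cardinal.mk s ≤ d := by simpa using this
    exact h2.trans (by exact_mod_cast hdr)
  change ringKrullDim R ≤ _
  rw [hd]
  rw [hd'] at htr
  exact_mod_cast htr

/-! ### The Zariski topology on affine space -/

/-- A set, not necessarily closed, is irreducible in the Zariski topology if and only if its
vanishing ideal is prime. -/
theorem isIrreducible_zariski_iff {σ : Type*} {V : Set (σ → ℂ)} :
    @IsIrreducible _ (zariskiTopology σ) V ↔ (vanishingIdeal ℂ V).IsPrime := by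
  let _ := zariskiTopology σ
  have hcl : ∀ Z : Set (σ → ℂ), IsClosed Z ↔ ∃ I : Ideal (MvPolynomial σ ℂ), Z = zeroLocus ℂ I :=
    fun Z => by
      rw [← isOpen_compl_iff]
      change Zᶜᶜ ∈ {V | ∃ I : Ideal (MvPolynomial σ ℂ), V = zeroLocus ℂ I} ↔ _
      rw [compl_compl]; rfl
  rw [IsIrreducible, isPreirreducible_iff_isClosed_union_isClosed]
  constructor
  · rintro ⟨⟨x, hx⟩, h⟩
    refine ⟨fun htop => ?_, fun {f g} hfg => ?_⟩
    · have h1 : (1 : MvPolynomial σ ℂ) ∈ vanishingIdeal ℂ V := htop ▸ Submodule.mem_top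
      simpa using h1 x hx
    · have key : ∀ f : MvPolynomial σ ℂ, V ⊆ zeroLocus ℂ (Ideal.span {f}) ↔
          f ∈ vanishingIdeal ℂ V := fun f => by
        rw [le_zeroLocus_iff_le_vanishingIdeal, Ideal.span_singleton_le_iff_mem]
      rw [← key, ← key]
      refine h _ _ ((hcl _).2 ⟨_, rfl⟩) ((hcl _).2 ⟨_, rfl⟩) fun y hy => ?_
      have := hfg y hy
      rw [map_mul, mul_eq_zero] at this
      simpa [zeroLocus_span] using this
  · intro h
    refine ⟨?_, ?_⟩
    · rw [Set.nonempty_iff_ne_empty]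
      rintro rfl
      exact h.ne_top vanishingIdeal_empty
    · intro Z₁ Z₂ h₁ h₂ hV
      obtain ⟨I, rfl⟩ := (hcl _).1 h₁
      obtain ⟨J, rfl⟩ := (hcl _).1 h₂
      simp only [le_zeroLocus_iff_le_vanishingIdeal]
      refine h.mul_le.1 (Ideal.mul_le.2 fun f hf g hg x hx => ?_)
      rw [map_mul, mul_eq_zero]
      exact (hV hx).imp (fun h => h f hf) (fun h => h g hg)

theorem vanishingIdeal_sUnion {σ : Type*} (c : Set (Set (σ → ℂ))) :
    vanishingIdeal ℂ (⋃₀ c) = sInf (vanishingIdeal ℂ '' c) := by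
  ext p
  simp only [mem_vanishingIdeal_iff, Set.mem_sUnion, Submodule.mem_sInf, Set.forall_mem_image]
  exact ⟨fun h W hW x hx => h x ⟨W, hW, hx⟩, fun h x ⟨W, hW, hx⟩ => h hW x hx⟩

theorem exists_isZariskiComponent_superset {σ : Type*} {X W : Set (σ → ℂ)} (hWX : W ⊆ X)
    (hW : (vanishingIdeal ℂ W).IsPrime) : ∃ V, W ⊆ V ∧ IsZariskiComponent X V := by
  refine zorn_subset_nonempty {V | V ⊆ X ∧ @IsIrreducible _ (zariskiTopology σ) V} ?_ W
    ⟨hWX, isIrreducible_zariski_iff.2 hW⟩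
  intro c hc hchain hne
  refine ⟨⋃₀ c, ⟨Set.sUnion_subset fun V hV => (hc hV).1, isIrreducible_zariski_iff.2 ?_⟩,
    fun V hV => Set.subset_sUnion_of_mem hV⟩
  rw [vanishingIdeal_sUnion]
  refine Ideal.sInf_isPrime_of_isChain (hne.image _) ?_ ?_
  · rintro _ ⟨V, hV, rfl⟩ _ ⟨V', hV', rfl⟩ -
    exact (hchain.total hV hV').symm.imp vanishingIdeal_anti_mono vanishingIdeal_anti_mono
  · rintro _ ⟨V, hV, rfl⟩
    exact isIrreducible_zariski_iff.1 (hc hV).2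

theorem vanishingIdeal_image_comp {σ τ : Type*} (e : τ → σ) (V : Set (σ → ℂ)) :
    vanishingIdeal ℂ ((fun x => x ∘ e) '' V) = (vanishingIdeal ℂ V).comap (rename (R := ℂ) e) := by
  ext p
  simp [mem_vanishingIdeal_iff, aeval_rename]

/-! ### Collinearity varieties -/

theorem collinear_triple_iff (a b c : Fin 2 → ℂ) :
    Collinear ℂ {a, b, c} ↔ (b 0 - a 0) * (c 1 - a 1) = (b 1 - a 1) * (c 0 - a 0) := by
  rw [collinear_iff_of_mem (p₀ := a) (by simp)]
  constructor
  · rintro ⟨v, hv⟩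
    obtain ⟨s, rfl⟩ := hv b (by simp)
    obtain ⟨t, rfl⟩ := hv c (by simp)
    simp; ring
  · intro h
    by_cases hb : b = a
    · refine ⟨c - a, ?_⟩
      simp only [Set.mem_insert_iff, Set.mem_singleton_iff, forall_eq_or_imp, forall_eq]
      exact ⟨⟨0, by simp⟩, ⟨0, by simp [hb]⟩, ⟨1, by simp⟩⟩
    · refine ⟨b - a, ?_⟩
      simp only [Set.mem_insert_iff, Set.mem_singleton_iff, forall_eq_or_imp, forall_eq]
      refine ⟨⟨0, by simp⟩, ⟨1, by simp⟩, ?_⟩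
      by_cases h0 : b 0 - a 0 = 0
      · have h1 : b 1 - a 1 ≠ 0 := fun h1 => hb <| by
          ext i; fin_cases i
          exacts [sub_eq_zero.1 h0, sub_eq_zero.1 h1]
        refine ⟨(c 1 - a 1) / (b 1 - a 1), ?_⟩
        ext i; fin_cases i
        · rw [h0, zero_mul, eq_comm, mul_eq_zero, or_iff_right h1] at h
          simpa [h0] using sub_eq_zero.1 h
        · simp [h1]
      · refine ⟨(c 0 - a 0) / (b 0 - a 0), ?_⟩
        ext i; fin_cases i
        · simp [h0]
        · simp; field_simp; linear_combination h

/-- The set `collinearityVariety T` is Zariski closed when `T` consists of triples, each triple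
contributing the determinant equation of `collinear_triple_iff`. -/
theorem exists_image_collinearityVariety_eq_zeroLocus {S : Type*} (T : Set (Finset S))
    (hT : ∀ t ∈ T, t.card = 3) : ∃ J : Ideal (MvPolynomial (S × Fin 2) ℂ),
      Function.uncurry '' collinearityVariety T = zeroLocus ℂ J := by
  classical
  have h : ∀ t : T, ∃ F : MvPolynomial (S × Fin 2) ℂ, ∀ p : S → Fin 2 → ℂ,
      Collinear ℂ (p '' (t : Set S)) ↔ aeval (Function.uncurry p) F = 0 := by
    rintro ⟨t, ht⟩
    obtain ⟨a, b, c, -, -, -, rfl⟩ := Finset.card_eq_three.1 (hT t ht)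
    refine ⟨(X (b, 0) - X (a, 0)) * (X (c, 1) - X (a, 1)) -
      (X (b, 1) - X (a, 1)) * (X (c, 0) - X (a, 0)), fun p => ?_⟩
    have : p '' (({a, b, c} : Finset S) : Set S) = {p a, p b, p c} := by
      simp [Set.image_insert_eq]
    rw [this, collinear_triple_iff]
    simp [sub_eq_zero]
  choose F hF using h
  refine ⟨Ideal.span (Set.range F), ?_⟩
  rw [zeroLocus_span]
  ext x
  obtain ⟨p, rfl⟩ : ∃ p, Function.uncurry p = x := ⟨Function.curry x, Function.uncurry_curry x⟩
  rw [Function.uncurry_injective.mem_set_image]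
  simp only [collinearityVariety, Set.mem_ofPred_eq, Set.forall_mem_range, ← hF]
  exact ⟨fun h t => h t t.2, fun h t ht => h ⟨t, ht⟩⟩

theorem comp_mem_collinearityVariety_restrictTriples {S : Type*} {T : Set (Finset S)}
    {p : S → Fin 2 → ℂ} (hp : p ∈ collinearityVariety T) (A : Set S) :
    (fun s : A => p s) ∈ collinearityVariety (restrictTriples T A) := fun t ht => by
  convert hp _ ht using 1
  ext x; simp

theorem proposition2p1 {S : Type*} [Finite S] (ℓ r : ℕ) (A : Fin ℓ → Set S)
    (hA : ∀ i j, i ≠ j → Disjoint (A i) (A j))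
    (T : Set (Finset S)) (hT : ∀ t ∈ T, t.card = 3)
    (P : S → Fin 2 → ℂ) (hP : P ∈ collinearityVariety T)
    (hrigid : ∀ i, IsRigid r (restrictTriples T (A i)) (fun s : A i => P s))
    (hunique : ∀ Q ∈ collinearityVariety T, (∀ i, ∀ s ∈ A i, Q s = P s) → Q = P) :
    IsRigid (ℓ * r) T P := by
  intro V hV hPV
  have hVprime : (vanishingIdeal ℂ V).IsPrime := isIrreducible_zariski_iff.1 hV.prop.2
  obtain ⟨K, hK⟩ := exists_image_collinearityVariety_eq_zeroLocus T hT
  let e : ∀ i, A i × Fin 2 → S × Fin 2 := fun i => Prod.map Subtype.val id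
  have hcomp : ∀ i, ∃ W, (fun x => x ∘ e i) '' V ⊆ W ∧
      IsZariskiComponent (Function.uncurry '' collinearityVariety (restrictTriples T (A i))) W := by
    refine fun i => exists_isZariskiComponent_superset ?_ ?_
    · rintro _ ⟨x, hx, rfl⟩
      obtain ⟨p, hp, rfl⟩ := hV.prop.1 hx
      exact ⟨_, comp_mem_collinearityVariety_restrictTriples hp (A i), rfl⟩
    · rw [vanishingIdeal_image_comp]
      exact hVprime.comap _
  choose W hVW hW using hcomp
  have hWprime : ∀ i, (vanishingIdeal ℂ (W i)).IsPrime :=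
    fun i => isIrreducible_zariski_iff.1 (hW i).prop.2
  refine ringKrullDim_quotient_le_mul_of_isolated e (vanishingIdeal ℂ V)
    (vanishingIdeal ℂ {Function.uncurry P})
    (vanishingIdeal_anti_mono (Set.singleton_subset_iff.2 hPV)) (fun i => vanishingIdeal ℂ (W i))
    (fun i => ?_) (fun i => hrigid i (W i) (hW i) (hVW i ⟨_, hPV, rfl⟩)) fun q hq hVq hqP => ?_
  · rw [← vanishingIdeal_image_comp]
    exact vanishingIdeal_anti_mono (hVW i)
  -- every zero of `q` is a configuration agreeing with `P` on each `A i`; by the Nullstellensatz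
  -- `q` is then the ideal of the point `P`
  · have hKV : K ≤ vanishingIdeal ℂ V :=
      le_zeroLocus_iff_le_vanishingIdeal.1 (hK ▸ hV.prop.1)
    have hsub : zeroLocus ℂ q ⊆ {Function.uncurry P} := fun x hx => by
      have hxK : x ∈ zeroLocus ℂ K := zeroLocus_anti_mono (hKV.trans hVq) hx
      rw [← hK] at hxK
      obtain ⟨Q, hQ, rfl⟩ := hxK
      refine congrArg Function.uncurry (hunique Q hQ fun i s hs => funext fun j => ?_)
      have := hx _ (hqP i (⟨s, hs⟩, j) (P s j) (by simp [e]))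
      simpa [e, sub_eq_zero] using this
    have hle : vanishingIdeal ℂ {Function.uncurry P} ≤ q := by
      rw [← IsPrime.vanishingIdeal_zeroLocus (K := ℂ) q]
      exact vanishingIdeal_anti_mono hsub
    have hmax : (vanishingIdeal ℂ {Function.uncurry P}).IsMaximal :=
      (isMaximal_iff_eq_vanishingIdeal_singleton).2 ⟨_, rfl⟩
    exact (hmax.eq_of_le hq.ne_top hle).symm
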